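/- Consider activated random walks (ARW) on $\mathbb Z$ with infinite sleep rate ($\lambda=\infty$): each particle carries an independent rate one Poisson clock and an independent walk with transition kernel $P$ started at its initial vertex; a particle is asleep if and only if it is alone at its vertex; when its clock rings, an active particle makes the next step of its walk, while a sleeping particle does nothing. Let $P$ be a transition kernel on $\mathbb Z$ allowing only nearest-neighbour jumps, i.e. $P(x,y)>0$ only if $|x-y|=1$. Let the initial occupation $\eta_0=(\eta_0(x))_{x\in\mathbb Z}$, with values in $\{0,1,2,\dots\}$, be random, with a law $\mathbf P$ that is invariant and ergodic under translations of $\mathbb Z$ and has mean $\mathbf E[\eta_0(0)]<1$. For $o\in\mathbb Z$ and $n\in\mathbb N$ let $W_o(n)$ be the maximum of $\sum_{x\in A}\eta_0(x)$ over all connected sets $A\subset\mathbb Z$ of $n$ vertices that contain $o$. For a vertex $x$ and $r\in\mathbb N$, let $\mathcal A_r(x)$ be the event that $x$ is visited by an active particle at least $r$ distinct times (visits begin at the hops of particles to $x$ and, if $\eta_0(x)\ge 1$, at time $0$). The process is called nonfixating if $\mathcal A_r(x)$ has probability one for every $x$ and every $r$; otherwise it is called fixating. Then for $\mathbf P$-almost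 every $\eta_0$: (a) for every $o\in\mathbb Z$, $W_o(n)<n$ for all sufficiently large $n$; and, for the ARW process with $\lambda=\infty$, kernel $P$ and initial occupation $\eta_0$, (b) the process is fixating; (c) almost surely, every vertex is visited by only finitely many distinct particles; (d) if moreover $P$ has no nonempty finite closed set (that is, for every nonempty finite $K\subset\mathbb Z$ there are $x\in K$ and $y\notin K$ with $P(x,y)>0$; for instance if $P$ is irreducible), then almost surely every vertex $x$ fixates: from some finite time on, no particle hops to $x$ and no active particle is at $x$. -/

import Mathlib

open MeasureTheory ProbabilityTheory Filter Topology
open scoped ENNReal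

namespace ARW

/-- The nearest-neighbour graph on the integers. -/
def intLine : SimpleGraph ℤ where
  Adj x y := |x - y| = 1
  symm := ⟨fun x y h => by rw [abs_sub_comm]; exact h⟩
  loopless := ⟨fun x h => by simp at h⟩

/-- The shift of an occupation of the integers. -/
def shift (η : ℤ → ℕ) : ℤ → ℕ := fun x => η (x + 1)

section Weight

variable {S : Type*}

/-- `W(n)`: the maximal weight `∑ x ∈ A, η x` among the connected vertex sets `A` of size `n`
that contain `o`. -/
noncomputable def maxWeight (G : SimpleGraph S) (η : S → ℕ) (o : S) (n : ℕ) : ℕ∞ :=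
  ⨆ A : Finset S, ⨆ _ : A.card = n ∧ o ∈ A ∧ (G.induce (A : Set S)).Connected,
    ((∑ x ∈ A, η x : ℕ) : ℕ∞)

/-- The kernel `P` only allows jumps along edges of `G`. -/
def NearestNeighbour (G : SimpleGraph S) (P : S → PMF S) : Prop :=
  ∀ x y, P x y ≠ 0 → G.Adj x y

/-- The kernel `P` has no nonempty finite closed set. -/
def NoFiniteTrap (P : S → PMF S) : Prop :=
  ∀ K : Finset S, K.Nonempty → ∃ x ∈ K, ∃ y ∉ K, P x y ≠ 0

end Weight

/-- The particles of an initial occupation `η₀`: the pair `(x, k)` is the `k`-th particle that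
starts at the vertex `x`. -/
abbrev Particle {S : Type*} (η₀ : S → ℕ) : Type _ := (x : S) × Fin (η₀ x)

section Dynamics

variable {S : Type*} {Ω : Type*} {η₀ : S → ℕ}

/-- The time of the `n`-th ring (`n = 0, 1, …`) of the clock of particle `i`, given the
successive waiting times `τ i 0, τ i 1, …`. -/
noncomputable def ringTime (τ : Particle η₀ → ℕ → Ω → ℝ) (i : Particle η₀) (n : ℕ) (ω : Ω) : ℝ :=
  ∑ k ∈ Finset.range (n + 1), τ i k ω

/-- The position of particle `i` at time `t`: the walk of particle `i` after the number
`J i t ω` of jumps that the particle has made by time `t`. -/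
def position (Y : Particle η₀ → ℕ → Ω → S) (J : Particle η₀ → ℝ → Ω → ℕ)
    (i : Particle η₀) (t : ℝ) (ω : Ω) : S :=
  Y i (J i t ω) ω

/-- `Z` is a discrete time Markov chain with kernel `P` started at `x`. -/
def IsMarkovChainFrom [MeasurableSpace Ω] (P : S → PMF S) (Q : Measure Ω) (x : S)
    (Z : ℕ → Ω → S) : Prop :=
  (∀ᵐ ω ∂Q, Z 0 ω = x) ∧
    ∀ (n : ℕ) (y : ℕ → S), y 0 = x →
      Q {ω | ∀ k ≤ n, Z k ω = y k} = ∏ k ∈ Finset.range n, P (y k) (y (k + 1))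

/-- Activated random walk with infinite sleep rate, kernel `P` and initial occupation `η₀`, on
the probability space `(Ω, Q)`. Particle `i` carries a rate one Poisson clock, with waiting
times `τ i`, and a walk `Y i` with kernel `P` that starts at the initial vertex of `i`; the
clocks and the walks are all independent. A particle is asleep if and only if it is alone at its
vertex. When its clock rings, a particle makes the next step of its walk if it is active, that
is, if just before the ring another particle is at the same vertex; otherwise nothing happens.
`J i t` is the number of jumps of particle `i` in the time interval `[0, t]`. -/
structure IsInfiniteSleepARW [MeasurableSpace S] [MeasurableSpace Ω] (P : S → PMF S)
    (η₀ : S → ℕ) (Q : Measure Ω) (τ : Particle η₀ → ℕ → Ω → ℝ) (Y : Particle η₀ → ℕ → Ω → S)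
    (J : Particle η₀ → ℝ → Ω → ℕ) : Prop where
  measurable_wait : ∀ i n, Measurable (τ i n)
  measurable_walk : ∀ i n, Measurable (Y i n)
  wait_law : ∀ i n, Q.map (τ i n) = expMeasure 1
  wait_indep : iIndepFun (fun p : Particle η₀ × ℕ => τ p.1 p.2) Q
  walk_law : ∀ i, IsMarkovChainFrom P Q i.1 (Y i)
  walk_indep : iIndepFun (fun (i : Particle η₀) (ω : Ω) (n : ℕ) => Y i n ω) Q
  wait_walk_indep : IndepFun (fun (ω : Ω) (p : Particle η₀ × ℕ) => τ p.1 p.2 ω)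
    (fun (ω : Ω) (p : Particle η₀ × ℕ) => Y p.1 p.2 ω) Q
  jumps : ∀ᵐ ω ∂Q, ∀ (i : Particle η₀) (t : ℝ), 0 ≤ t →
    (J i t ω : ℕ∞) = Set.encard {n : ℕ | ringTime τ i n ω ≤ t ∧
      ∃ j, j ≠ i ∧ ∀ᶠ u in 𝓝[<] (ringTime τ i n ω), position Y J j u ω = position Y J i u ω}

/-! In the following, `X i t ω` is the position of particle `i` at time `t`. -/

/-- The particles that are at `x` at some time. -/
def visitors (X : Particle η₀ → ℝ → Ω → S) (x : S) (ω : Ω) : Set (Particle η₀) :=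
  {i | ∃ t, 0 ≤ t ∧ X i t ω = x}

/-- The times at which a visit of a particle to `x` begins: the times of hops to `x` and, if `x`
is occupied initially, time zero (all particles begin as active; a hopping particle is active). -/
def visitTimes (X : Particle η₀ → ℝ → Ω → S) (x : S) (ω : Ω) : Set ℝ :=
  {t | 0 ≤ t ∧ ∃ i, X i t ω = x ∧ (0 < t → ∀ᶠ u in 𝓝[<] t, X i u ω ≠ x)}

/-- The event `A_r(x)`: the vertex `x` is visited at least `r` distinct times. -/
def VisitedAtLeast (X : Particle η₀ → ℝ → Ω → S) (r : ℕ) (x : S) (ω : Ω) : Prop :=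
  (r : ℕ∞) ≤ (visitTimes X x ω).encard

/-- The process is nonfixating if, for every vertex `x` and every `r`, the event `A_r(x)` has
probability one. -/
def Nonfixating [MeasurableSpace Ω] (Q : Measure Ω) (X : Particle η₀ → ℝ → Ω → S) : Prop :=
  ∀ (x : S) (r : ℕ), ∀ᵐ ω ∂Q, VisitedAtLeast X r x ω

/-- The process is fixating if it is not nonfixating. -/
def Fixating [MeasurableSpace Ω] (Q : Measure Ω) (X : Particle η₀ → ℝ → Ω → S) : Prop :=
  ¬ Nonfixating Q X

/-- The vertex `x` fixates: from some finite time on, no particle hops to `x` and there is no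
active particle (that is, no two particles) at `x`. -/
def FixatesAt (X : Particle η₀ → ℝ → Ω → S) (x : S) (ω : Ω) : Prop :=
  ∃ T : ℝ, 0 ≤ T ∧ ∀ t, T ≤ t → t ∉ visitTimes X x ω ∧
    ∀ i j, X i t ω = x → X j t ω = x → i = j

end Dynamics

end ARW

/-! A particle leaves a vertex only if another particle is there, and no two clocks ring together,
so a vertex that has once been visited is occupied forever (`exists_at_of_visited`). Jumps go to
nearest neighbours, so no particle crosses an unvisited vertex. Hence a finite maximal interval of
vertices visited by time `t` is filled by particles that started in it, and its length is at most
its initial weight. Density below one makes every long interval around `o` weigh less than its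
length, so unvisited vertices lie within a bounded distance of `o`, uniformly in `t`
(`exists_gap_at`). The visited set only grows and there are finitely many candidates, so some vertex
on each side of `o` is never visited (`exists_gap`). This gives (b), and it confines the particles,
which gives (c). For (d), a walk without finite traps would leave its confinement, so each particle
jumps only finitely often, while particles that share a vertex must keep jumping.

Two inputs are needed. The linear weight bound `Subcritical` follows from the maximal ergodic
argument applied to the shift and its inverse. The maximal visited intervals are finite because, by
Borel–Cantelli, displacements up to time `t` are sublinear in the starting distance, and then
density below one cannot fill a half-line (`exists_unoccupied`). All probabilistic facts about
clocks and jumps are collected in `Regular`; from there the argument is pathwise. -/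

namespace ARW

/-! ### Maximal ergodic argument. -/

section Maximal

variable {α : Type*}

/-- The maximum of the first `n + 1` Birkhoff sums, the empty sum included. -/
noncomputable def birkhoffMax (T : α → α) (f : α → ℝ) : ℕ → α → ℝ
  | 0, _ => 0
  | n + 1, x => max 0 (f x + birkhoffMax T f n (T x))

lemma birkhoffMax_nonneg (T : α → α) (f : α → ℝ) (n : ℕ) (x : α) : 0 ≤ birkhoffMax T f n x := by
  cases n with
  | zero => exact le_rfl
  | succ n => exact le_max_left _ _

lemma birkhoffMax_le_succ (T : α → α) (f : α → ℝ) (n : ℕ) (x : α) :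
    birkhoffMax T f n x ≤ birkhoffMax T f (n + 1) x := by
  induction n generalizing x with
  | zero => exact le_max_left _ _
  | succ n ih => exact max_le_max le_rfl (add_le_add le_rfl (ih (T x)))

lemma birkhoffMax_monotone (T : α → α) (f : α → ℝ) (x : α) :
    Monotone fun n => birkhoffMax T f n x :=
  monotone_nat_of_le_succ fun n => birkhoffMax_le_succ T f n x

lemma birkhoffSum_le_birkhoffMax (T : α → α) (f : α → ℝ) (n : ℕ) (x : α) :
    birkhoffSum T f n x ≤ birkhoffMax T f n x := by
  induction n generalizing x with
  | zero => simp [birkhoffMax]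
  | succ n ih =>
    rw [birkhoffSum_succ']
    exact (add_le_add le_rfl (ih (T x))).trans (le_max_right _ _)

/-- This makes the event of bounded maxima invariant; a natural bound `C` keeps it a countable
union. -/
lemma bddAbove_birkhoffMax_comp (T : α → α) (f : α → ℝ) (x : α) :
    (∃ C : ℕ, ∀ n, birkhoffMax T f n (T x) ≤ C) ↔ ∃ C : ℕ, ∀ n, birkhoffMax T f n x ≤ C := by
  constructor
  · rintro ⟨C, hC⟩
    obtain ⟨D, hD⟩ := exists_nat_ge (f x + C)
    refine ⟨D, fun n => ?_⟩
    cases n with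
    | zero => exact Nat.cast_nonneg D
    | succ n => exact max_le (Nat.cast_nonneg D) (by linarith [hC n])
  · rintro ⟨C, hC⟩
    obtain ⟨D, hD⟩ := exists_nat_ge (C - f x)
    refine ⟨D, fun n => ?_⟩
    have := (le_max_right 0 (f x + birkhoffMax T f n (T x))).trans (hC (n + 1))
    linarith

variable [MeasurableSpace α] {μ : Measure α} {T : α → α} {f : α → ℝ}

lemma measurable_birkhoffMax (hT : Measurable T) (hf : Measurable f) (n : ℕ) :
    Measurable (birkhoffMax T f n) := by
  induction n with
  | zero => exact measurable_const
  | succ n ih => exact measurable_const.max (hf.add (ih.comp hT))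

lemma integrable_birkhoffMax (hT : MeasurePreserving T μ μ) (hi : Integrable f μ) (n : ℕ) :
    Integrable (birkhoffMax T f n) μ := by
  induction n with
  | zero => exact integrable_zero _ _ _
  | succ n ih =>
    exact (integrable_zero _ _ _).sup (hi.add (hT.integrable_comp_of_integrable ih))

/-- The Birkhoff sums of a function of negative mean are bounded above almost everywhere. -/
theorem ae_bddAbove_birkhoffSum [IsProbabilityMeasure μ] (hT : Ergodic T μ) (hf : Measurable f)
    (hi : Integrable f μ) (hneg : ∫ x, f x ∂μ < 0) :
    ∀ᵐ x ∂μ, ∃ C : ℝ, ∀ n, birkhoffSum T f n x ≤ C := by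
  have hTm := hT.toMeasurePreserving.measurable
  set E : Set α := {x | ∃ C : ℕ, ∀ n, birkhoffMax T f n x ≤ C} with hE
  have hEm : MeasurableSet E := by
    rw [hE]
    simp only [Set.ofPred_exists, Set.ofPred_forall]
    exact MeasurableSet.iUnion fun C => MeasurableSet.iInter fun n =>
      measurableSet_le (measurable_birkhoffMax hTm hf n) measurable_const
  have hEinv : T ⁻¹' E = E := Set.ext fun x => bddAbove_birkhoffMax_comp T f x
  rcases hT.toPreErgodic.ae_mem_or_ae_notMem hEm hEinv with h | h
  · filter_upwards [h] with x ⟨C, hC⟩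
    exact ⟨C, fun n => (birkhoffSum_le_birkhoffMax T f n x).trans (hC n)⟩
  exfalso
  have hTi := hT.toMeasurePreserving.integrable_comp_of_integrable (g := f) hi
  -- With `M_n = birkhoffMax T f n`, the integrand is `M_{n+1} - M_n ∘ T`. Its integral is
  -- nonnegative because `T` preserves the measure and `M_n ≤ M_{n+1}`; if `M_n → ∞` almost
  -- everywhere it tends to `f`, which would force `∫ f ≥ 0`.
  have hlim : Tendsto (fun n => ∫ x, max (-birkhoffMax T f n (T x)) (f x) ∂μ) atTop
      (𝓝 (∫ x, f x ∂μ)) := by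
    refine tendsto_integral_of_dominated_convergence (fun x => |f x|) (fun n => ?_) hi.abs
      (fun n => Eventually.of_forall fun x => ?_) ?_
    · exact (((measurable_birkhoffMax hTm hf n).comp hTm).neg.max hf).aestronglyMeasurable
    · have := birkhoffMax_nonneg T f n (T x)
      rw [Real.norm_eq_abs, abs_le]
      refine ⟨?_, max_le (by linarith [abs_nonneg (f x)]) (le_abs_self _)⟩
      exact (neg_abs_le (f x)).trans (le_max_right _ _)
    · filter_upwards [h] with x hx
      have hx' : ¬ ∃ C : ℕ, ∀ n, birkhoffMax T f n (T x) ≤ C := fun hc =>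
        hx ((bddAbove_birkhoffMax_comp T f x).1 hc)
      push Not at hx'
      obtain ⟨C, hC⟩ := exists_nat_ge (-f x)
      obtain ⟨N, hN⟩ := hx' C
      refine tendsto_const_nhds.congr' ?_
      filter_upwards [eventually_ge_atTop N] with n hn
      have := birkhoffMax_monotone T f (T x) hn
      rw [max_eq_right]
      simp only at this
      linarith
  have hnn : ∀ n, 0 ≤ ∫ x, max (-birkhoffMax T f n (T x)) (f x) ∂μ := by
    intro n
    have hi1 := integrable_birkhoffMax hT.toMeasurePreserving hi (n + 1)
    have hi0 := integrable_birkhoffMax hT.toMeasurePreserving hi n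
    have hi0' := hT.toMeasurePreserving.integrable_comp_of_integrable hi0
    have heq : ∀ x, max (-birkhoffMax T f n (T x)) (f x)
        = birkhoffMax T f (n + 1) x - (birkhoffMax T f n ∘ T) x := by
      intro x
      simp only [birkhoffMax, Function.comp]
      rw [max_sub_sub_right 0 _ _ |>.symm]
      simp
    simp_rw [heq]
    rw [integral_sub hi1 hi0']
    have : ∫ x, (birkhoffMax T f n ∘ T) x ∂μ = ∫ x, birkhoffMax T f n x ∂μ := by
      have h2 := integral_map (μ := μ) hTm.aemeasurable (f := birkhoffMax T f n)
        (by rw [hT.toMeasurePreserving.map_eq]; exact hi0.aestronglyMeasurable)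
      rw [hT.toMeasurePreserving.map_eq] at h2
      exact h2.symm
    rw [this, sub_nonneg]
    exact integral_mono hi0 hi1 fun x => birkhoffMax_le_succ T f n x
  exact absurd (ge_of_tendsto' hlim hnn) (not_le.2 hneg)

end Maximal

/-! ### Interval weights at density below one. -/

/-- The weight of an interval around the origin is at most linear in its length, with a slope
less than one. -/
def Subcritical (η : ℤ → ℕ) : Prop :=
  ∃ c C : ℝ, 0 ≤ c ∧ c < 1 ∧ 0 ≤ C ∧ ∀ a b : ℕ,
    ((∑ x ∈ Finset.Icc (-a : ℤ) b, η x : ℕ) : ℝ) ≤ c * (a + b + 1) + C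

/-- The shift as a measurable equivalence. -/
def shiftEquiv : (ℤ → ℕ) ≃ᵐ (ℤ → ℕ) where
  toFun := shift
  invFun η x := η (x - 1)
  left_inv η := by funext x; simp [shift]
  right_inv η := by funext x; simp [shift]
  measurable_toFun := measurable_pi_lambda _ fun x => measurable_pi_apply (x + 1)
  measurable_invFun := measurable_pi_lambda _ fun x => measurable_pi_apply (x - 1)

lemma iterate_shift (η : ℤ → ℕ) (k : ℕ) (x : ℤ) : (shift^[k] η) x = η (x + k) := by
  induction k generalizing x with
  | zero => simp
  | succ k ih =>
    rw [Function.iterate_succ_apply', shift, ih]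
    congr 1
    push_cast
    ring

lemma iterate_shift_symm (η : ℤ → ℕ) (k : ℕ) (x : ℤ) :
    (shiftEquiv.symm^[k] η) x = η (x - k) := by
  induction k generalizing x with
  | zero => simp
  | succ k ih =>
    rw [Function.iterate_succ_apply']
    change (shiftEquiv.symm^[k] η) (x - 1) = _
    rw [ih]
    congr 1
    push_cast
    ring

lemma ae_subcritical (law : Measure (ℤ → ℕ)) [IsProbabilityMeasure law]
    (hergodic : Ergodic shift law) (hmean : ∫⁻ η, (η 0 : ℝ≥0∞) ∂law < 1) :
    ∀ᵐ η ∂law, Subcritical η := by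
  have hm0 : Measurable fun η : ℤ → ℕ => ((η 0 : ℕ) : ℝ) :=
    measurable_from_nat.comp (measurable_pi_apply 0)
  have hlint : ∫⁻ η, ENNReal.ofReal ((η 0 : ℕ) : ℝ) ∂law = ∫⁻ η, (η 0 : ℝ≥0∞) ∂law := by
    simp
  have hint : Integrable (fun η : ℤ → ℕ => ((η 0 : ℕ) : ℝ)) law := by
    refine ⟨hm0.aestronglyMeasurable, ?_⟩
    rw [hasFiniteIntegral_iff_ofReal (Eventually.of_forall fun η => Nat.cast_nonneg _), hlint]
    exact hmean.trans ENNReal.one_lt_top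
  set m := ∫ η, ((η 0 : ℕ) : ℝ) ∂law with hm
  have hm_nonneg : 0 ≤ m := integral_nonneg fun η => Nat.cast_nonneg _
  have hm_lt : m < 1 := by
    rw [hm, integral_eq_lintegral_of_nonneg_ae (Eventually.of_forall fun η => Nat.cast_nonneg _)
      hm0.aestronglyMeasurable, hlint, ← ENNReal.toReal_one]
    exact (ENNReal.toReal_lt_toReal hmean.ne_top ENNReal.one_ne_top).2 hmean
  -- Any slope strictly between the mean and one would do.
  set c := (m + 1) / 2 with hc
  set f : (ℤ → ℕ) → ℝ := fun η => (η 0 : ℕ) - c with hf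
  have hfm : Measurable f := hm0.sub_const c
  have hfi : Integrable f law := hint.sub (integrable_const c)
  have hneg : ∫ η, f η ∂law < 0 := by
    rw [hf, integral_sub hint (integrable_const c)]
    simp only [integral_const, probReal_univ, smul_eq_mul, one_mul]
    rw [← hm, hc]
    linarith
  have h1 := ae_bddAbove_birkhoffSum hergodic hfm hfi hneg
  have hsymm : Ergodic shiftEquiv.symm law := Ergodic.symm (e := shiftEquiv) hergodic
  have h2 := ae_bddAbove_birkhoffSum hsymm hfm hfi hneg
  filter_upwards [h1, h2] with η ⟨C₁, hC₁⟩ ⟨C₂, hC₂⟩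
  have e1 : ∀ b : ℕ, ∑ k ∈ Finset.range (b + 1), (η k : ℝ) ≤ c * (b + 1) + C₁ := by
    intro b
    have := hC₁ (b + 1)
    simp only [birkhoffSum, hf, iterate_shift, zero_add, Finset.sum_sub_distrib, Finset.sum_const,
      Finset.card_range, nsmul_eq_mul] at this
    push_cast at this
    linarith
  have e2 : ∀ a : ℕ, ∑ k ∈ Finset.range (a + 1), (η (-k) : ℝ) ≤ c * (a + 1) + C₂ := by
    intro a
    have := hC₂ (a + 1)
    simp only [birkhoffSum, hf, iterate_shift_symm, zero_sub, Finset.sum_sub_distrib,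
      Finset.sum_const, Finset.card_range, nsmul_eq_mul] at this
    push_cast at this
    linarith
  have hc0 : 0 ≤ c := by rw [hc]; linarith
  -- The extra `c` pays for the origin, which belongs to both half-lines.
  refine ⟨c, c + |C₁| + |C₂|, hc0, by rw [hc]; linarith, by positivity, fun a b => ?_⟩
  have hsub : Finset.Icc (-a : ℤ) b ⊆ (Finset.range (a + 1)).image (fun k : ℕ => (-k : ℤ)) ∪
      (Finset.range (b + 1)).image (fun k : ℕ => (k : ℤ)) := by
    intro x hx
    rw [Finset.mem_Icc] at hx
    simp only [Finset.mem_union, Finset.mem_image, Finset.mem_range]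
    rcases le_total 0 x with h | h
    · exact Or.inr ⟨x.toNat, by omega, by omega⟩
    · exact Or.inl ⟨(-x).toNat, by omega, by omega⟩
  have hle : ∑ x ∈ Finset.Icc (-a : ℤ) b, η x ≤
      ∑ k ∈ Finset.range (a + 1), η (-k) + ∑ k ∈ Finset.range (b + 1), η k := by
    refine (Finset.sum_le_sum_of_subset hsub).trans ?_
    have hui := Finset.sum_union_inter (f := η)
      (s₁ := (Finset.range (a + 1)).image (fun k : ℕ => (-k : ℤ)))
      (s₂ := (Finset.range (b + 1)).image (fun k : ℕ => (k : ℤ)))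
    rw [Finset.sum_image (fun i _ j _ h => by simpa using h),
      Finset.sum_image (fun i _ j _ h => by simpa using h)] at hui
    omega
  have hle' : ((∑ x ∈ Finset.Icc (-a : ℤ) b, η x : ℕ) : ℝ) ≤
      ∑ k ∈ Finset.range (a + 1), (η (-k) : ℝ) + ∑ k ∈ Finset.range (b + 1), (η k : ℝ) := by
    exact_mod_cast hle
  linarith [e1 b, e2 a, le_abs_self C₁, le_abs_self C₂]

/-- The interval weight in a subcritical occupation is less than its length, for intervals
around `o` that are long enough. -/
lemma Subcritical.sum_Icc_lt {η : ℤ → ℕ} (h : Subcritical η) (o : ℤ) :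
    ∃ N : ℕ, ∀ u v : ℤ, u ≤ o → o ≤ v → N ≤ v - u + 1 →
      ((∑ x ∈ Finset.Icc u v, η x : ℕ) : ℤ) < v - u + 1 := by
  obtain ⟨c, C, hc0, hc1, hC, h⟩ := h
  -- Extending `[u, v]` to contain the origin adds at most `|o|` to its length `L`; the choice of
  -- `N` gives `c * (L + |o|) + C < L` for `L ≥ N`.
  obtain ⟨N, hN⟩ := exists_nat_gt ((c * |(o : ℝ)| + C) / (1 - c))
  rw [div_lt_iff₀ (by linarith)] at hN
  refine ⟨N, fun u v hu hv huv => ?_⟩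
  obtain ⟨a, ha⟩ := Int.eq_ofNat_of_zero_le (show 0 ≤ -min u 0 by omega)
  obtain ⟨b, hb⟩ := Int.eq_ofNat_of_zero_le (show 0 ≤ max v 0 by omega)
  have hsub : Finset.Icc u v ⊆ Finset.Icc (-a : ℤ) b :=
    Finset.Icc_subset_Icc (by omega) (by omega)
  have h1 : ((∑ x ∈ Finset.Icc u v, η x : ℕ) : ℝ) ≤ c * (a + b + 1) + C :=
    le_trans (by exact_mod_cast Finset.sum_le_sum_of_subset hsub) (h a b)
  have h2 : (a : ℤ) + b + 1 ≤ v - u + 1 + |o| := by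
    rcases abs_cases o with ⟨h, _⟩ | ⟨h, _⟩ <;> omega
  have h2' : (a : ℝ) + b + 1 ≤ v - u + 1 + |(o : ℝ)| := by exact_mod_cast h2
  have h3 : (N : ℝ) ≤ v - u + 1 := by exact_mod_cast huv
  have h4 : c * ((a : ℝ) + b + 1) ≤ c * (v - u + 1 + |(o : ℝ)|) :=
    mul_le_mul_of_nonneg_left h2' hc0
  have h5 : (N : ℝ) * (1 - c) ≤ (v - u + 1) * (1 - c) :=
    mul_le_mul_of_nonneg_right h3 (by linarith)
  have : ((∑ x ∈ Finset.Icc u v, η x : ℕ) : ℝ) < v - u + 1 := by nlinarith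
  exact_mod_cast this

/-- A finite connected vertex set of the integer line is an interval. -/
lemma exists_eq_Icc_of_connected {A : Finset ℤ} (hA : (intLine.induce (A : Set ℤ)).Connected) :
    ∃ u v : ℤ, u ≤ v ∧ A = Finset.Icc u v := by
  have hne : A.Nonempty := by
    obtain ⟨x⟩ := hA.nonempty
    exact ⟨x.1, x.2⟩
  refine ⟨A.min' hne, A.max' hne, A.min'_le _ (A.max'_mem hne), ?_⟩
  refine Finset.Subset.antisymm
    (fun x hx => Finset.mem_Icc.2 ⟨A.min'_le x hx, A.le_max' x hx⟩) fun z hz => ?_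
  rw [Finset.mem_Icc] at hz
  by_contra hzA
  -- Unit steps cannot jump over a missing `z`, so a walk inside `A` that starts below `z` stays
  -- below it.
  have key : ∀ (x y : (A : Set ℤ)), (intLine.induce (A : Set ℤ)).Walk x y →
      x.1 < z → y.1 < z := by
    intro x y p
    induction p with
    | nil => exact id
    | cons h p ih =>
      rename_i a b d
      intro ha
      apply ih
      have h' : |a.1 - b.1| = 1 := h
      have hb : b.1 ≠ z := fun e => hzA (e ▸ b.2)
      rcases abs_cases (a.1 - b.1) with ⟨h1, _⟩ | ⟨h1, _⟩ <;> omega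
  obtain ⟨p⟩ := hA.preconnected ⟨_, A.min'_mem hne⟩ ⟨_, A.max'_mem hne⟩
  have hmin : A.min' hne ≠ z := fun e => hzA (e ▸ A.min'_mem hne)
  have := key _ _ p (lt_of_le_of_ne hz.1 hmin)
  simp only at this
  omega

lemma Subcritical.maxWeight_lt {η : ℤ → ℕ} (h : Subcritical η) (o : ℤ) :
    ∀ᶠ n : ℕ in atTop, maxWeight intLine η o n < n := by
  obtain ⟨N, hN⟩ := h.sum_Icc_lt o
  filter_upwards [eventually_ge_atTop N, eventually_gt_atTop 0] with n hn hn0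
  have hle : maxWeight intLine η o n ≤ ((n - 1 : ℕ) : ℕ∞) := by
    refine iSup_le fun A => iSup_le fun ⟨hcard, ho, hA⟩ => ?_
    obtain ⟨u, v, huv, rfl⟩ := exists_eq_Icc_of_connected hA
    rw [Finset.mem_Icc] at ho
    rw [Int.card_Icc] at hcard
    have := hN u v ho.1 ho.2 (by omega)
    have h2 : ∑ x ∈ Finset.Icc u v, η x ≤ n - 1 := by omega
    exact_mod_cast h2
  refine hle.trans_lt ?_
  exact_mod_cast Nat.sub_lt hn0 one_pos

/-! ### Exit of Markov chains from finite sets. -/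

section Walk

variable {S : Type*}

/-- The probability that the chain with kernel `P` started at `z` spends the steps `1, …, n`
in the finite set `K`. -/
noncomputable def stayProb (P : S → PMF S) (K : Finset S) : ℕ → S → ℝ≥0∞
  | 0, _ => 1
  | n + 1, z => ∑ y ∈ K, P z y * stayProb P K n y

lemma stayProb_succ_le (P : S → PMF S) (K : Finset S) (n : ℕ) (z : S) :
    stayProb P K (n + 1) z ≤ stayProb P K n z := by
  induction n generalizing z with
  | zero =>
    simp only [stayProb, mul_one]
    exact (ENNReal.sum_le_tsum K).trans (P z).tsum_coe.le
  | succ n ih => exact Finset.sum_le_sum fun y _ => mul_le_mul_right (ih y) _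

lemma tendsto_stayProb (P : S → PMF S) (K : Finset S) (z : S) :
    Tendsto (fun n => stayProb P K n z) atTop (𝓝 (⨅ n, stayProb P K n z)) :=
  tendsto_atTop_iInf (antitone_nat_of_succ_le fun n => stayProb_succ_le P K n z)

lemma iInf_stayProb_eq_sum (P : S → PMF S) (K : Finset S) (z : S) :
    ⨅ n, stayProb P K n z = ∑ y ∈ K, P z y * ⨅ n, stayProb P K n y := by
  refine tendsto_nhds_unique ((tendsto_stayProb P K z).comp (tendsto_add_atTop_nat 1)) ?_
  refine tendsto_finsetSum _ fun y _ => ?_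
  exact ENNReal.Tendsto.const_mul (tendsto_stayProb P K y) (Or.inr ((P z).apply_ne_top y))

/-- Maximum principle: the probability `h` of staying in `K` forever satisfies `h = ∑ y ∈ K, P · y *
h y`. Were its maximum positive, the set of maximizers would have to be closed, since a step out of
it loses strictly. -/
lemma iInf_stayProb_eq_zero {P : S → PMF S} (hP : NoFiniteTrap P) (K : Finset S) {z : S}
    (hz : z ∈ K) : ⨅ n, stayProb P K n z = 0 := by
  classical
  set h : S → ℝ≥0∞ := fun z => ⨅ n, stayProb P K n z with hh
  obtain ⟨w, hw, hmax⟩ := K.exists_max_image h ⟨z, hz⟩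
  by_contra hne
  have hM : h w ≠ 0 := fun e => hne (le_antisymm ((hmax z hz).trans e.le) bot_le)
  have hMtop : h w ≠ ∞ := ((iInf_le _ 0).trans_lt ENNReal.one_lt_top).ne
  obtain ⟨x, hx, y, hy, hxy⟩ := hP (K.filter fun v => h v = h w) ⟨w, by simp [hw]⟩
  rw [Finset.mem_filter] at hx hy
  have hlt : (if y ∈ K then h y else 0) < h w := by
    split_ifs with hyK
    · exact lt_of_le_of_ne (hmax y hyK) fun e => hy ⟨hyK, e⟩
    · exact pos_iff_ne_zero.2 hM
  have hle : ∀ v, P x v * (if v ∈ K then h v else 0) ≤ P x v * h w := by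
    intro v
    refine mul_le_mul_right ?_ _
    split_ifs with hv
    · exact hmax v hv
    · exact bot_le
  have hsum : ∑' v, P x v * (if v ∈ K then h v else 0) = h w := by
    rw [← hx.2, hh]
    simp only
    rw [iInf_stayProb_eq_sum P K x, tsum_eq_sum (s := K)]
    · exact Finset.sum_congr rfl fun v hv => by rw [if_pos hv]
    · intro v hv
      rw [if_neg hv, mul_zero]
  have hsum' : ∑' v, P x v * h w = h w := by
    rw [ENNReal.tsum_mul_right, (P x).tsum_coe, one_mul]
  have := ENNReal.tsum_lt_tsum (i := y) (by rw [hsum]; exact hMtop) hle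
    (ENNReal.mul_lt_mul_right hxy ((P x).apply_ne_top y) hlt)
  rw [hsum, hsum'] at this
  exact lt_irrefl _ this

variable {Ω : Type*} [MeasurableSpace Ω] {Q : Measure Ω} {P : S → PMF S} {x : S} {Z : ℕ → Ω → S}

/-- Only cylinder probabilities are given, so the induction runs over all prescribed prefixes `y`
and splits according to the value at step `m + 1`. -/
lemma IsMarkovChainFrom.measure_stay_le (hZ : IsMarkovChainFrom P Q x Z) (K : Finset S)
    (n m : ℕ) (y : ℕ → S) (hy : y 0 = x) :
    Q {ω | (∀ k ≤ m, Z k ω = y k) ∧ ∀ k, m < k → k ≤ m + n → Z k ω ∈ K} ≤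
      (∏ k ∈ Finset.range m, P (y k) (y (k + 1))) * stayProb P K n (y m) := by
  induction n generalizing m y with
  | zero =>
    rw [stayProb, mul_one, ← hZ.2 m y hy]
    exact measure_mono fun ω h => h.1
  | succ n ih =>
    have hsub : {ω | (∀ k ≤ m, Z k ω = y k) ∧ ∀ k, m < k → k ≤ m + (n + 1) → Z k ω ∈ K} ⊆
        ⋃ z ∈ K, {ω | (∀ k ≤ m + 1, Z k ω = Function.update y (m + 1) z k) ∧
          ∀ k, m + 1 < k → k ≤ m + 1 + n → Z k ω ∈ K} := by
      rintro ω ⟨h1, h2⟩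
      simp only [Set.mem_iUnion]
      refine ⟨Z (m + 1) ω, h2 _ (by omega) (by omega), fun k hk => ?_, fun k hk hk' =>
        h2 k (by omega) (by omega)⟩
      rcases Nat.lt_or_eq_of_le hk with h | rfl
      · rw [Function.update_of_ne h.ne]
        exact h1 k (by omega)
      · rw [Function.update_self]
    refine (measure_mono hsub).trans ((measure_biUnion_finset_le K _).trans ?_)
    rw [stayProb, Finset.mul_sum]
    refine Finset.sum_le_sum fun z _ => ?_
    refine (ih (m + 1) (Function.update y (m + 1) z)
      (by rw [Function.update_of_ne (by omega), hy])).trans (le_of_eq ?_)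
    rw [Finset.prod_range_succ, Function.update_self, Function.update_of_ne (by omega), mul_assoc]
    congr 1
    refine Finset.prod_congr rfl fun k hk => ?_
    rw [Finset.mem_range] at hk
    rw [Function.update_of_ne (by omega), Function.update_of_ne (by omega)]

/-- A Markov chain whose kernel has no finite closed set leaves every finite set. -/
lemma IsMarkovChainFrom.ae_exists_notMem (hZ : IsMarkovChainFrom P Q x Z) (hP : NoFiniteTrap P)
    (K : Finset S) : ∀ᵐ ω ∂Q, ∃ k, Z k ω ∉ K := by
  by_cases hx : x ∈ K
  · have hle : ∀ n, Q {ω | Z 0 ω = x ∧ ∀ k, Z k ω ∈ K} ≤ stayProb P K n x := by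
      intro n
      have := hZ.measure_stay_le K n 0 (fun _ => x) rfl
      rw [Finset.range_zero, Finset.prod_empty, one_mul] at this
      refine (measure_mono ?_).trans this
      rintro ω ⟨h0, h⟩
      refine ⟨fun k hk => ?_, fun k _ _ => h k⟩
      rw [Nat.le_zero.1 hk]
      exact h0
    have h0 : Q {ω | Z 0 ω = x ∧ ∀ k, Z k ω ∈ K} = 0 :=
      le_antisymm ((le_iInf hle).trans (iInf_stayProb_eq_zero hP K hx).le) bot_le
    filter_upwards [hZ.1, measure_eq_zero_iff_ae_notMem.1 h0] with ω h1 h2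
    by_contra! hcon
    exact h2 ⟨h1, hcon⟩
  · filter_upwards [hZ.1] with ω h
    exact ⟨0, by rwa [h]⟩

/-- A Markov chain only makes steps of positive probability. -/
lemma IsMarkovChainFrom.ae_step_ne_zero [Countable S] (hZ : IsMarkovChainFrom P Q x Z) :
    ∀ᵐ ω ∂Q, ∀ n, P (Z n ω) (Z (n + 1) ω) ≠ 0 := by
  rw [ae_all_iff]
  intro n
  -- There are countably many finite paths, and one whose last step has probability zero is a null
  -- cylinder. Beyond its end the path is padded with `x`.
  have h : ∀ᵐ ω ∂Q, ∀ f : Fin (n + 2) → S,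
      (fun k : ℕ => if h : k < n + 2 then f ⟨k, h⟩ else x) 0 = x →
      P (f ⟨n, by omega⟩) (f ⟨n + 1, by omega⟩) = 0 →
      ¬ ∀ k ≤ n + 1, Z k ω = (fun k : ℕ => if h : k < n + 2 then f ⟨k, h⟩ else x) k := by
    rw [ae_all_iff]
    intro f
    by_cases hf : (fun k : ℕ => if h : k < n + 2 then f ⟨k, h⟩ else x) 0 = x ∧
      P (f ⟨n, by omega⟩) (f ⟨n + 1, by omega⟩) = 0
    · have h0 : Q {ω | ∀ k ≤ n + 1,
          Z k ω = (fun k : ℕ => if h : k < n + 2 then f ⟨k, h⟩ else x) k} = 0 := by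
        rw [hZ.2 (n + 1) _ hf.1]
        refine Finset.prod_eq_zero (Finset.self_mem_range_succ n) ?_
        simpa using hf.2
      filter_upwards [measure_eq_zero_iff_ae_notMem.1 h0] with ω hω _ _
      exact hω
    · exact Eventually.of_forall fun ω h1 h2 => absurd ⟨h1, h2⟩ hf
  filter_upwards [h, hZ.1] with ω hω h0 hcon
  refine hω (fun k => Z k ω) (by simpa using h0) hcon fun k hk => ?_
  simp only
  rw [dif_pos (by omega)]

end Walk

/-! ### Exponential clocks. -/

section Clock

instance nullSingletonClass_expMeasure : NullSingletonClass (expMeasure 1) :=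
  ⟨fun x => (withDensity_absolutelyContinuous (volume : Measure ℝ) (gammaPDF 1 1))
    (measure_singleton x)⟩

instance isProbabilityMeasure_expMeasure_one : IsProbabilityMeasure (expMeasure 1) :=
  isProbabilityMeasure_expMeasure one_pos

lemma expMeasure_Iic (t : ℝ) (ht : 0 ≤ t) :
    expMeasure 1 (Set.Iic t) = ENNReal.ofReal (1 - Real.exp (-t)) := by
  have h := cdf_expMeasure_eq one_pos t
  rw [cdf_eq_real, if_pos ht, one_mul] at h
  rw [← h, measureReal_def, ENNReal.ofReal_toReal (measure_ne_top _ _)]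

/-- Fubini on the diagonal: each fibre is a single point, hence null for the law of `X`. -/
lemma measure_eq_eq_zero_of_indepFun {Ω : Type*} [MeasurableSpace Ω] {Q : Measure Ω}
    [IsProbabilityMeasure Q] {X Z : Ω → ℝ} (hX : Measurable X) (hZ : Measurable Z)
    (hXZ : IndepFun X Z Q) [NullSingletonClass (Q.map X)] : Q {ω | X ω = Z ω} = 0 := by
  have : IsProbabilityMeasure (Q.map X) := Measure.isProbabilityMeasure_map hX.aemeasurable
  have : IsProbabilityMeasure (Q.map Z) := Measure.isProbabilityMeasure_map hZ.aemeasurable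
  have h := (indepFun_iff_map_prod_eq_prod_map_map hX.aemeasurable hZ.aemeasurable).1 hXZ
  have hd : MeasurableSet (Set.diagonal ℝ) := measurableSet_diagonal
  have h1 : Q {ω | X ω = Z ω} = Q.map (fun ω => (X ω, Z ω)) (Set.diagonal ℝ) := by
    rw [Measure.map_apply (hX.prodMk hZ) hd]
    rfl
  rw [h1, h, Measure.prod_apply_symm hd]
  refine lintegral_eq_zero_of_ae_eq_zero (Eventually.of_forall fun z => ?_)
  have : (fun x => (x, z)) ⁻¹' Set.diagonal ℝ = {z} := by
    ext x
    simp
  change Q.map X ((fun x => (x, z)) ⁻¹' Set.diagonal ℝ) = 0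
  rw [this]
  exact measure_singleton z

variable {Ω : Type*} [MeasurableSpace Ω] {Q : Measure Ω} {η₀ : ℤ → ℕ}
  {τ : Particle η₀ → ℕ → Ω → ℝ}

lemma ae_wait_pos (hm : ∀ i n, Measurable (τ i n)) (hl : ∀ i n, Q.map (τ i n) = expMeasure 1) :
    ∀ᵐ ω ∂Q, ∀ i n, 0 < τ i n ω := by
  rw [ae_all_iff]
  intro i
  rw [ae_all_iff]
  intro n
  have h : Q (τ i n ⁻¹' Set.Iic 0) = 0 := by
    rw [← Measure.map_apply (hm i n) measurableSet_Iic, hl, expMeasure_Iic 0 le_rfl]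
    simp
  filter_upwards [measure_eq_zero_iff_ae_notMem.1 h] with ω hω
  exact not_le.1 hω

/-- No two particles ring at the same time. -/
lemma ae_ringTime_ne [IsProbabilityMeasure Q] (hm : ∀ i n, Measurable (τ i n))
    (hl : ∀ i n, Q.map (τ i n) = expMeasure 1)
    (hi : iIndepFun (fun p : Particle η₀ × ℕ => τ p.1 p.2) Q) :
    ∀ᵐ ω ∂Q, ∀ i j, i ≠ j → ∀ n m, ringTime τ i n ω ≠ ringTime τ j m ω := by
  simp_rw [ae_all_iff]
  intro i j hij n m
  -- With these signs the two rings coincide exactly when `τ i n` equals the sum of `f` over `s ∪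
  -- u`, which is independent of `τ i n`.
  set f : Particle η₀ × ℕ → Ω → ℝ := fun p ω => (if p.1 = i then -1 else 1) * τ p.1 p.2 ω with hf
  have hfm : ∀ p, Measurable (f p) := fun p => (hm p.1 p.2).const_mul _
  have hfi : iIndepFun f Q :=
    hi.comp (fun p x => (if p.1 = i then -1 else 1) * x) fun p => measurable_const_mul _
  set s : Finset (Particle η₀ × ℕ) := (Finset.range n).image (fun k => (i, k)) with hs
  set u : Finset (Particle η₀ × ℕ) := (Finset.range (m + 1)).image (fun k => (j, k)) with hu
  have hdisj : Disjoint s u := by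
    rw [Finset.disjoint_left]
    simp only [hs, hu, Finset.mem_image]
    rintro p ⟨a, _, rfl⟩ ⟨b, _, hb⟩
    exact hij (Prod.ext_iff.1 hb).1.symm
  have hnot : (i, n) ∉ s ∪ u := by
    simp only [hs, hu, Finset.mem_union, Finset.mem_image, Finset.mem_range, Prod.mk.injEq, not_or]
    constructor
    · rintro ⟨a, ha, _, rfl⟩
      exact lt_irrefl _ ha
    · rintro ⟨a, _, h, _⟩
      exact hij h.symm
  have hsum : ∀ ω, (∑ p ∈ s ∪ u, f p) ω = ringTime τ j m ω - ∑ k ∈ Finset.range n, τ i k ω := by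
    intro ω
    rw [Finset.sum_apply, Finset.sum_union hdisj, hs, hu,
      Finset.sum_image (fun _ _ _ _ h => (Prod.ext_iff.1 h).2),
      Finset.sum_image (fun _ _ _ _ h => (Prod.ext_iff.1 h).2)]
    simp only [hf, if_neg hij.symm, if_true, neg_one_mul, one_mul, Finset.sum_neg_distrib, ringTime]
    ring
  have hind := (hfi.indepFun_finsetSum_of_notMem hfm hnot).symm.comp measurable_neg measurable_id
  have hfin : ∀ ω, (Neg.neg ∘ f (i, n)) ω = τ i n ω := by
    intro ω
    simp [hf]
  rw [show (Neg.neg ∘ f (i, n)) = τ i n from funext hfin] at hind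
  have : NullSingletonClass (Q.map (τ i n)) := by
    rw [hl]
    infer_instance
  have h0 := measure_eq_eq_zero_of_indepFun (hm i n)
    (measurable_id.comp (by fun_prop : Measurable (∑ p ∈ s ∪ u, f p))) hind
  filter_upwards [measure_eq_zero_iff_ae_notMem.1 h0] with ω hω hcon
  refine hω ?_
  change τ i n ω = (∑ p ∈ s ∪ u, f p) ω
  rw [hsum, ← hcon, ringTime, Finset.sum_range_succ]
  ring

/-- The tail of the ring times is geometric. -/
lemma measure_ringTime_le (hm : ∀ i n, Measurable (τ i n))
    (hl : ∀ i n, Q.map (τ i n) = expMeasure 1)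
    (hi : iIndepFun (fun p : Particle η₀ × ℕ => τ p.1 p.2) Q) (i : Particle η₀) (n : ℕ) {t : ℝ}
    (ht : 0 ≤ t) :
    Q {ω | ringTime τ i n ω ≤ t} ≤ ENNReal.ofReal ((1 - Real.exp (-t)) ^ (n + 1)) := by
  have hq : 0 ≤ 1 - Real.exp (-t) := sub_nonneg.2 (Real.exp_le_one_iff.2 (by linarith))
  set s : Finset (Particle η₀ × ℕ) := (Finset.range (n + 1)).image (fun k => (i, k)) with hs
  -- If ring `n` comes by time `t`, each of the first `n + 1` waiting times is at most `t`.
  have h1 : Q (⋂ p ∈ s, τ p.1 p.2 ⁻¹' Set.Iic t) =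
      ENNReal.ofReal ((1 - Real.exp (-t)) ^ (n + 1)) := by
    have := hi.measure_inter_preimage_eq_mul s (sets := fun _ => Set.Iic t)
      (fun _ _ => measurableSet_Iic)
    rw [this, hs, Finset.prod_image (fun _ _ _ _ h => (Prod.ext_iff.1 h).2)]
    simp_rw [← Measure.map_apply (hm _ _) measurableSet_Iic, hl]
    rw [Finset.prod_const, Finset.card_range, expMeasure_Iic t ht, ENNReal.ofReal_pow hq]
  rw [← h1]
  refine measure_mono_ae ?_
  filter_upwards [ae_wait_pos hm hl] with ω hω (hle : ringTime τ i n ω ≤ t)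
  change ω ∈ ⋂ p ∈ s, τ p.1 p.2 ⁻¹' Set.Iic t
  simp only [Set.mem_iInter, hs, Finset.mem_image]
  rintro p ⟨k, hk, rfl⟩
  exact (Finset.single_le_sum (f := fun k => τ i k ω) (fun k _ => (hω i k).le) hk).trans hle

lemma ae_finite_ringTime_le (hm : ∀ i n, Measurable (τ i n))
    (hl : ∀ i n, Q.map (τ i n) = expMeasure 1)
    (hi : iIndepFun (fun p : Particle η₀ × ℕ => τ p.1 p.2) Q) :
    ∀ᵐ ω ∂Q, ∀ (i : Particle η₀) (t : ℕ), {n | ringTime τ i n ω ≤ t}.Finite := by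
  simp_rw [ae_all_iff]
  intro i t
  have hq : 0 ≤ 1 - Real.exp (-(t : ℝ)) :=
    sub_nonneg.2 (Real.exp_le_one_iff.2 (by simp))
  have hs : Summable fun n : ℕ => (1 - Real.exp (-(t : ℝ))) ^ (n + 1) :=
    (summable_nat_add_iff 1).2
      (summable_geometric_of_lt_one hq (by linarith [Real.exp_pos (-(t : ℝ))]))
  refine ae_finite_setOfPred_mem (s := fun n => {ω | ringTime τ i n ω ≤ t})
    (ne_top_of_le_ne_top hs.tsum_ofReal_ne_top (ENNReal.tsum_le_tsum fun n => ?_))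
  exact measure_ringTime_le hm hl hi i n (Nat.cast_nonneg t)

lemma Subcritical.exists_le_mul {η : ℤ → ℕ} (h : Subcritical η) :
    ∃ A : ℝ, 0 ≤ A ∧ ∀ x : ℤ, (η x : ℝ) ≤ A * (x.natAbs + 1) := by
  obtain ⟨c, C, hc0, hc1, hC, h⟩ := h
  refine ⟨2 + C, by positivity, fun x => ?_⟩
  have h1 : η x ≤ ∑ y ∈ Finset.Icc (-x.natAbs : ℤ) x.natAbs, η y :=
    Finset.single_le_sum (f := η) (fun _ _ => Nat.zero_le _)
      (by rw [Finset.mem_Icc]; omega)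
  have h2 : (η x : ℝ) ≤ c * (x.natAbs + x.natAbs + 1) + C :=
    le_trans (by exact_mod_cast h1) (h x.natAbs x.natAbs)
  have h3 : (0 : ℝ) ≤ x.natAbs := Nat.cast_nonneg _
  nlinarith [mul_nonneg hC h3]

/-- Only finitely many particles ring more often by a given time than a given fraction of the
distance of their starting point to the origin. -/
lemma ae_finite_fast (hη : Subcritical η₀) (hm : ∀ i n, Measurable (τ i n))
    (hl : ∀ i n, Q.map (τ i n) = expMeasure 1)
    (hi : iIndepFun (fun p : Particle η₀ × ℕ => τ p.1 p.2) Q) :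
    ∀ᵐ ω ∂Q, ∀ K t : ℕ, 0 < K →
      {i : Particle η₀ | ringTime τ i (i.1.natAbs / K) ω ≤ t}.Finite := by
  simp_rw [ae_all_iff]
  intro K t hK
  obtain ⟨A, hA, hηA⟩ := hη.exists_le_mul
  set q : ℝ := 1 - Real.exp (-(t : ℝ)) with hqdef
  have hq : 0 ≤ q := sub_nonneg.2 (Real.exp_le_one_iff.2 (by simp))
  have hq1 : q < 1 := by linarith [Real.exp_pos (-(t : ℝ))]
  have hK' : (1 : ℝ) ≤ K := by exact_mod_cast hK
  -- A substitute for the `K`-th root of `q`: Bernoulli's inequality gives `q ≤ r ^ K`, with `r <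
  -- 1`.
  set r : ℝ := 1 + -((1 - q) / K) with hr
  have hdiv : (1 - q) / K ≤ 1 - q := div_le_self (by linarith) hK'
  have hdiv0 : 0 < (1 - q) / K := div_pos (by linarith) (by linarith)
  have hr0 : 0 ≤ r := by rw [hr]; linarith
  have hr1 : r < 1 := by rw [hr]; linarith
  have hqr : q ≤ r ^ K := by
    have := one_add_mul_le_pow (a := -((1 - q) / K)) (by linarith) K
    rw [← hr] at this
    refine le_trans (le_of_eq ?_) this
    field_simp
    ring
  have hpow : ∀ n : ℕ, q ^ (n / K + 1) ≤ r ^ n := by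
    intro n
    calc q ^ (n / K + 1) ≤ (r ^ K) ^ (n / K + 1) := pow_le_pow_left₀ hq hqr _
      _ = r ^ (K * (n / K + 1)) := (pow_mul _ _ _).symm
      _ ≤ r ^ n := pow_le_pow_of_le_one hr0 hr1.le (Nat.lt_mul_div_succ n hK).le
  have hsn : Summable fun n : ℕ => A * ((n : ℝ) + 1) * r ^ n := by
    have h1 := summable_pow_mul_geometric_of_norm_lt_one (R := ℝ) 1
      (by rwa [Real.norm_of_nonneg hr0] : ‖r‖ < 1)
    have h2 := summable_geometric_of_lt_one hr0 hr1
    refine ((h1.add h2).mul_left A).congr fun n => ?_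
    ring
  have hsz : Summable fun x : ℤ => A * ((x.natAbs : ℝ) + 1) * r ^ x.natAbs :=
    Summable.of_nat_of_neg (by simpa using hsn) (by simpa using hsn)
  refine ae_finite_setOfPred_mem
    (s := fun i : Particle η₀ => {ω | ringTime τ i (i.1.natAbs / K) ω ≤ t})
    (ne_top_of_le_ne_top hsz.tsum_ofReal_ne_top ?_)
  rw [ENNReal.tsum_sigma']
  refine ENNReal.tsum_le_tsum fun x => ?_
  calc ∑' k : Fin (η₀ x), Q {ω | ringTime τ ⟨x, k⟩ (x.natAbs / K) ω ≤ t}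
      ≤ ∑' k : Fin (η₀ x), ENNReal.ofReal (r ^ x.natAbs) := by
        refine ENNReal.tsum_le_tsum fun k => ?_
        refine (measure_ringTime_le hm hl hi _ _ (Nat.cast_nonneg t)).trans ?_
        exact ENNReal.ofReal_le_ofReal (hpow _)
    _ = ENNReal.ofReal (η₀ x * r ^ x.natAbs) := by
        rw [tsum_fintype, Finset.sum_const, Finset.card_univ, Fintype.card_fin, nsmul_eq_mul,
          ENNReal.ofReal_mul (Nat.cast_nonneg _), ENNReal.ofReal_natCast]
    _ ≤ _ := ENNReal.ofReal_le_ofReal (mul_le_mul_of_nonneg_right (hηA x) (pow_nonneg hr0 _))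

end Clock

/-! ### Counting particles against vertices. -/

/-- The particles that start in a given interval. -/
noncomputable def startIn (η : ℤ → ℕ) (u v : ℤ) : Finset (Particle η) :=
  (Finset.Icc u v).sigma fun _ => Finset.univ

lemma mem_startIn {η : ℤ → ℕ} {u v : ℤ} {i : Particle η} :
    i ∈ startIn η u v ↔ u ≤ i.1 ∧ i.1 ≤ v := by
  simp [startIn]

lemma card_startIn (η : ℤ → ℕ) (u v : ℤ) :
    (startIn η u v).card = ∑ x ∈ Finset.Icc u v, η x := by
  simp [startIn]

/-- If the density of particles is less than one and the displacements are sublinear, then no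
ray is fully occupied. -/
lemma exists_unoccupied {I : Type*} (start X : I → ℤ) {c C₀ : ℝ} (hc1 : c < 1)
    (hcount : ∀ a b : ℕ, ∃ F : Finset I, (F.card : ℝ) ≤ c * (a + b + 1) + C₀ ∧
      ∀ i, -a ≤ start i → start i ≤ b → i ∈ F)
    (hX : ∀ K : ℕ, 0 < K → ∃ C : ℕ, ∀ i, |X i - start i| ≤ ((start i).natAbs / K + C : ℕ))
    (o : ℤ) : ∃ y, o ≤ y ∧ ∀ i, X i ≠ y := by
  by_contra! hcon
  have : Nonempty I := ⟨(hcon o le_rfl).choose⟩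
  choose! f hf using hcon
  -- `K` is so large that density `c` on length `(K + 2) * M` falls short of `K * M` particles; then
  -- `M` absorbs the bounded terms.
  obtain ⟨K₀, hK₀⟩ := exists_nat_gt (2 * c / (1 - c))
  rw [div_lt_iff₀ (by linarith)] at hK₀
  set K := K₀ + 2 with hKdef
  have hK : c * (K + 2) < K := by
    push_cast [hKdef]
    linarith
  obtain ⟨C, hC⟩ := hX K (by omega)
  obtain ⟨M₀, hM₀⟩ := exists_nat_gt ((c * (2 * C + 1) + C₀ + C + |(o : ℝ)|) / (K - c * (K + 2)))
  rw [div_lt_iff₀ (by linarith)] at hM₀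
  set M := M₀ + C + o.natAbs with hM
  obtain ⟨F, hFcard, hF⟩ := hcount (2 * C) ((K + 2) * M)
  have hKM : (C : ℤ) + |o| ≤ K * M := by
    have h1 : (1 : ℤ) ≤ K := by omega
    have h2 : (C : ℤ) + |o| ≤ M := by rw [Int.abs_eq_natAbs]; omega
    nlinarith
  -- A particle at `y ≥ 0` that started at `x < 0` has `|x| ≤ |x| / 2 + C`. One that started at `x >
  -- 0` has `x * (1 - 1 / K) ≤ K * M`, and `(K + 2) * (K - 1) ≥ K ^ 2` since `K ≥ 2`.
  have hmaps : ∀ y ∈ Finset.Icc |o| (K * M - C : ℤ), f y ∈ F := by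
    intro y hy
    rw [Finset.mem_Icc] at hy
    have hoy : o ≤ y := (le_abs_self o).trans hy.1
    have hy0 : 0 ≤ y := (abs_nonneg o).trans hy.1
    have hi := hC (f y)
    rw [hf y hoy] at hi
    set x := start (f y) with hx
    have hdiv : x.natAbs / K * K ≤ x.natAbs := Nat.div_mul_le_self _ _
    have hdiv2 : x.natAbs / K ≤ x.natAbs / 2 := Nat.div_le_div_left (by omega) (by norm_num)
    obtain ⟨d, hd⟩ : ∃ d : ℕ, d = x.natAbs / K := ⟨_, rfl⟩
    rw [← hd] at hi hdiv hdiv2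
    obtain ⟨hi1, hi2⟩ := abs_le.1 hi
    rw [Nat.cast_add] at hi1 hi2
    apply hF
    · push_cast
      omega
    · rcases le_or_gt x 0 with h | h
      · exact h.trans (by positivity)
      · have hxn : (x.natAbs : ℤ) = x := Int.natAbs_of_nonneg h.le
        have e1 : x ≤ K * M + d := by linarith [hy.2]
        have e2 : (d : ℤ) * K ≤ x := by
          rw [← hxn]
          exact_mod_cast hdiv
        have hK2 : (2 : ℤ) ≤ K := by omega
        have hM0 : (0 : ℤ) ≤ M := Int.natCast_nonneg M
        push_cast
        have e3 : (K - 1) * (x - (K + 2) * M) ≤ (0 : ℤ) := by nlinarith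
        by_contra hlt
        push Not at hlt
        nlinarith
  have hcard := Finset.card_le_card_of_injOn f hmaps (by
    intro y hy z hz hyz
    rw [Finset.coe_Icc, Set.mem_Icc] at hy hz
    rw [← hf y ((le_abs_self o).trans hy.1), hyz, hf z ((le_abs_self o).trans hz.1)])
  rw [Int.card_Icc] at hcard
  have h1 : (K * M - C : ℤ) + 1 - |o| ≤ F.card := by omega
  have h2 : (K * M - C : ℝ) + 1 - |(o : ℝ)| ≤ F.card := by exact_mod_cast h1
  push_cast at hFcard
  have h3 : (M₀ : ℝ) * (K - c * (K + 2)) ≤ M * (K - c * (K + 2)) :=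
    mul_le_mul_of_nonneg_right (by exact_mod_cast (by omega : M₀ ≤ M)) (by linarith)
  nlinarith

/-! ### Pathwise analysis of a regular realization. -/

/-- A realization of the activated random walk on the integers with ring times `R`, walks `Y` and
jump counts `J` that has the almost sure properties of the process. -/
structure Regular {η₀ : ℤ → ℕ} (R : Particle η₀ → ℕ → ℝ) (Y : Particle η₀ → ℕ → ℤ)
    (J : Particle η₀ → ℝ → ℕ) : Prop where
  ring_pos : ∀ i n, 0 < R i n
  ring_strictMono : ∀ i, StrictMono (R i)
  ring_finite : ∀ i (t : ℕ), {n | R i n ≤ t}.Finite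
  ring_ne : ∀ i j, i ≠ j → ∀ n m, R i n ≠ R j m
  fast_finite : ∀ K t : ℕ, 0 < K → {i : Particle η₀ | R i (i.1.natAbs / K) ≤ t}.Finite
  start : ∀ i, Y i 0 = i.1
  step : ∀ i n, |Y i n - Y i (n + 1)| = 1
  jumps : ∀ i t, 0 ≤ t → (J i t : ℕ∞) = Set.encard {n : ℕ | R i n ≤ t ∧
    ∃ j, j ≠ i ∧ ∀ᶠ u in 𝓝[<] (R i n), Y j (J j u) = Y i (J i u)}

namespace Regular

variable {η₀ : ℤ → ℕ} {R : Particle η₀ → ℕ → ℝ} {Y : Particle η₀ → ℕ → ℤ}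
  {J : Particle η₀ → ℝ → ℕ}

variable (R Y J) in
/-- Particle `i` is active just before its `n`-th ring. -/
def ActiveAt (i : Particle η₀) (n : ℕ) : Prop :=
  ∃ j, j ≠ i ∧ ∀ᶠ u in 𝓝[<] (R i n), Y j (J j u) = Y i (J i u)

open scoped Classical in
variable (R Y J) in
/-- The number of active rings among the first `n` rings of particle `i`. -/
noncomputable def activeCount (i : Particle η₀) (n : ℕ) : ℕ :=
  Nat.count (ActiveAt R Y J i) n

lemma activeCount_succ_of_active {i : Particle η₀} {n : ℕ} (h : ActiveAt R Y J i n) :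
    activeCount R Y J i (n + 1) = activeCount R Y J i n + 1 := by
  rw [activeCount, Nat.count_succ, if_pos h, activeCount]

lemma activeCount_succ_of_not_active {i : Particle η₀} {n : ℕ} (h : ¬ ActiveAt R Y J i n) :
    activeCount R Y J i (n + 1) = activeCount R Y J i n := by
  rw [activeCount, Nat.count_succ, if_neg h, add_zero, activeCount]

lemma activeCount_surj (i : Particle η₀) (N k : ℕ) (hk : k ≤ activeCount R Y J i N) :
    ∃ n ≤ N, activeCount R Y J i n = k := by
  induction N with
  | zero =>
    refine ⟨0, le_rfl, ?_⟩
    have : activeCount R Y J i 0 = 0 := by simp [activeCount]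
    omega
  | succ N ih =>
    by_cases h : k ≤ activeCount R Y J i N
    · obtain ⟨n, hn, e⟩ := ih h
      exact ⟨n, by omega, e⟩
    · refine ⟨N + 1, le_rfl, ?_⟩
      by_cases ha : ActiveAt R Y J i N
      · rw [activeCount_succ_of_active ha] at hk ⊢
        omega
      · rw [activeCount_succ_of_not_active ha] at hk ⊢
        omega

variable (h : Regular R Y J)
include h

lemma exists_ring_gt (i : Particle η₀) (t : ℝ) : ∃ n, t < R i n := by
  obtain ⟨T, hT⟩ := exists_nat_ge t
  obtain ⟨n, hn⟩ := (h.ring_finite i T).exists_notMem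
  exact ⟨n, hT.trans_lt (not_le.1 hn)⟩

lemma exists_ring_le_iff (i : Particle η₀) (t : ℝ) : ∃ N, ∀ n, R i n ≤ t ↔ n < N := by
  classical
  refine ⟨Nat.find (h.exists_ring_gt i t), fun n => ⟨fun hn => ?_, fun hn => ?_⟩⟩
  · by_contra! hle
    have := (h.ring_strictMono i).monotone hle
    linarith [Nat.find_spec (h.exists_ring_gt i t)]
  · exact not_lt.1 (Nat.find_min _ hn)

lemma exists_ring_lt_iff (i : Particle η₀) (t : ℝ) : ∃ N, ∀ n, R i n < t ↔ n < N := by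
  classical
  have hex : ∃ n, t ≤ R i n := (h.exists_ring_gt i t).imp fun _ => le_of_lt
  refine ⟨Nat.find hex, fun n => ⟨fun hn => ?_, fun hn => ?_⟩⟩
  · by_contra! hle
    have := (h.ring_strictMono i).monotone hle
    linarith [Nat.find_spec hex]
  · exact not_le.1 (Nat.find_min _ hn)

lemma jumps_eq {i : Particle η₀} {t : ℝ} (ht : 0 ≤ t) {N : ℕ} (hN : ∀ n, R i n ≤ t ↔ n < N) :
    J i t = activeCount R Y J i N := by
  classical
  have := h.jumps i t ht
  have hset : {n : ℕ | R i n ≤ t ∧ ∃ j, j ≠ i ∧ ∀ᶠ u in 𝓝[<] (R i n), Y j (J j u) = Y i (J i u)}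
      = ((Finset.range N).filter (ActiveAt R Y J i) : Finset ℕ) := by
    ext n
    simp only [Set.mem_ofPred_eq, Finset.coe_filter, Finset.mem_range, hN]
    rfl
  rw [hset, Set.encard_coe_eq_coe_finsetCard] at this
  rw [activeCount, Nat.count_eq_card_filter_range]
  exact_mod_cast this

lemma jumps_zero (i : Particle η₀) : J i 0 = 0 := by
  rw [h.jumps_eq le_rfl (N := 0) fun n => ⟨fun hn => absurd hn (not_le.2 (h.ring_pos i n)),
    fun hn => absurd hn (Nat.not_lt_zero n)⟩]
  simp [activeCount]

lemma jumps_mono (i : Particle η₀) {s t : ℝ} (hs : 0 ≤ s) (hst : s ≤ t) : J i s ≤ J i t := by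
  classical
  obtain ⟨M, hM⟩ := h.exists_ring_le_iff i s
  obtain ⟨N, hN⟩ := h.exists_ring_le_iff i t
  rw [h.jumps_eq hs hM, h.jumps_eq (hs.trans hst) hN]
  refine Nat.count_monotone _ ?_
  by_contra! hlt
  exact lt_irrefl N ((hN N).1 (((hM N).2 hlt).trans hst))

lemma jumps_le {i : Particle η₀} {t : ℝ} (ht : 0 ≤ t) {m : ℕ} (hm : t < R i m) : J i t ≤ m := by
  classical
  obtain ⟨N, hN⟩ := h.exists_ring_le_iff i t
  rw [h.jumps_eq ht hN]
  refine (Nat.count_le (p := ActiveAt R Y J i) (n := N)).trans ?_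
  by_contra! hlt
  exact absurd ((hN m).2 hlt) (not_le.2 hm)

lemma eventually_right (i : Particle η₀) {t : ℝ} (ht : 0 ≤ t) :
    ∀ᶠ u in 𝓝[≥] t, J i u = J i t := by
  obtain ⟨N, hN⟩ := h.exists_ring_le_iff i t
  have hlt : t < R i N := not_le.1 fun hc => lt_irrefl N ((hN N).1 hc)
  filter_upwards [Ico_mem_nhdsGE hlt] with u hu
  rw [h.jumps_eq ht hN, h.jumps_eq (ht.trans hu.1) (N := N)]
  intro n
  refine ⟨fun hn => ?_, fun hn => ((hN n).2 hn).trans hu.1⟩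
  by_contra! hle
  have := (h.ring_strictMono i).monotone hle
  linarith [hu.2]

lemma eventually_left (i : Particle η₀) {t : ℝ} (ht : 0 < t) {N : ℕ}
    (hN : ∀ n, R i n < t ↔ n < N) : ∀ᶠ u in 𝓝[<] t, J i u = activeCount R Y J i N := by
  have h1 : ∀ᶠ u in 𝓝[<] t, ∀ n ∈ Finset.range N, R i n < u := by
    rw [Filter.eventually_all_finset]
    intro n hn
    exact (lt_mem_nhds ((hN n).2 (Finset.mem_range.1 hn))).filter_mono nhdsWithin_le_nhds
  filter_upwards [h1, (lt_mem_nhds ht).filter_mono nhdsWithin_le_nhds, self_mem_nhdsWithin]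
    with u hu hu0 hut
  refine h.jumps_eq (le_of_lt hu0) fun n => ⟨fun hn => (hN n).1 (hn.trans_lt hut), fun hn => ?_⟩
  exact (hu n (Finset.mem_range.2 hn)).le

lemma eventually_left_of_ne (i : Particle η₀) {t : ℝ} (ht : 0 < t) (hne : ∀ n, R i n ≠ t) :
    ∀ᶠ u in 𝓝[<] t, J i u = J i t := by
  obtain ⟨N, hN⟩ := h.exists_ring_le_iff i t
  rw [h.jumps_eq ht.le hN]
  exact h.eventually_left i ht fun n => ⟨fun hn => (hN n).1 hn.le,
    fun hn => lt_of_le_of_ne ((hN n).2 hn) (hne n)⟩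

lemma eventually_left_ring (i : Particle η₀) (n : ℕ) :
    ∀ᶠ u in 𝓝[<] (R i n), J i u = activeCount R Y J i n :=
  h.eventually_left i (h.ring_pos i n) fun _ => (h.ring_strictMono i).lt_iff_lt

lemma jumps_ring (i : Particle η₀) (n : ℕ) : J i (R i n) = activeCount R Y J i (n + 1) :=
  h.jumps_eq (h.ring_pos i n).le fun _ =>
    (h.ring_strictMono i).le_iff_le.trans Nat.lt_succ_iff.symm

/-- The number of jumps takes every intermediate value. -/
lemma exists_jumps_eq (i : Particle η₀) {t : ℝ} (ht : 0 ≤ t) {k : ℕ} (hk : k ≤ J i t) :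
    ∃ s, 0 ≤ s ∧ s ≤ t ∧ J i s = k := by
  obtain ⟨N, hN⟩ := h.exists_ring_le_iff i t
  rw [h.jumps_eq ht hN] at hk
  obtain ⟨n, hn, e⟩ := activeCount_surj i N k hk
  cases n with
  | zero =>
    refine ⟨0, le_rfl, ht, ?_⟩
    rw [h.jumps_zero, ← e]
    simp [activeCount]
  | succ n => exact ⟨R i n, (h.ring_pos i n).le, (hN n).2 hn, by rw [h.jumps_ring, e]⟩

lemma abs_walk_sub_le (i : Particle η₀) (n : ℕ) : |Y i n - i.1| ≤ n := by
  induction n with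
  | zero => simp [h.start]
  | succ n ih =>
    have := h.step i n
    rw [abs_le] at ih ⊢
    push_cast
    rcases abs_cases (Y i n - Y i (n + 1)) with ⟨e, _⟩ | ⟨e, _⟩ <;> omega

/-- All but finitely many particles ring at most `|start| / K` times; `C` covers the exceptions. -/
lemma exists_jumps_le {t : ℝ} (ht : 0 ≤ t) {K : ℕ} (hK : 0 < K) :
    ∃ C : ℕ, ∀ i, J i t ≤ i.1.natAbs / K + C := by
  obtain ⟨T, hT⟩ := exists_nat_ge t
  obtain ⟨C, hC⟩ := ((h.fast_finite K T hK).image fun i => J i t).bddAbove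
  refine ⟨C, fun i => ?_⟩
  by_cases hi : R i (i.1.natAbs / K) ≤ T
  · exact (hC ⟨i, hi, rfl⟩).trans (Nat.le_add_left _ _)
  · exact (h.jumps_le ht (hT.trans_lt (not_le.1 hi))).trans (Nat.le_add_right _ _)

/-- A particle that moves at most half its starting distance plus a constant reaches `x` only from a
bounded range. -/
lemma finite_visitors_until (x : ℤ) {t : ℝ} (ht : 0 ≤ t) :
    {i | ∃ s, 0 ≤ s ∧ s ≤ t ∧ Y i (J i s) = x}.Finite := by
  obtain ⟨C, hC⟩ := h.exists_jumps_le ht (K := 2) (by norm_num)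
  refine (startIn η₀
    (-(2 * |x| + 2 * C + 2)) (2 * |x| + 2 * C + 2)).finite_toSet.subset ?_
  rintro i ⟨s, hs, hst, rfl⟩
  have h1 := h.abs_walk_sub_le i (J i s)
  have h2 := (h.jumps_mono i hs hst).trans (hC i)
  rw [Finset.mem_coe, mem_startIn]
  rw [abs_le] at h1
  rcases abs_cases (Y i (J i s)) with ⟨e, _⟩ | ⟨e, _⟩ <;> rw [e] <;> constructor <;> omega

/-- A vertex that has been visited stays occupied. -/
lemma exists_at_of_visited {i : Particle η₀} {s t : ℝ} (hs : 0 ≤ s) (hst : s ≤ t) :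
    ∃ j, Y j (J j t) = Y i (J i s) := by
  set x := Y i (J i s) with hx
  by_contra hcon
  -- Consider the infimum `r` of the later times at which `x` is empty. If `x` is occupied at `r`,
  -- right-continuity of the jump counts is contradicted; so its last occupant must leave exactly at
  -- `r`.
  set B : Set ℝ := {u | s ≤ u ∧ u ≤ t ∧ ¬ ∃ j, Y j (J j u) = x} with hB
  have htB : t ∈ B := ⟨hst, le_rfl, hcon⟩
  have hBb : BddBelow B := ⟨s, fun u hu => hu.1⟩
  set r := sInf B with hr
  have hsr : s ≤ r := le_csInf ⟨t, htB⟩ fun u hu => hu.1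
  have hrt : r ≤ t := csInf_le hBb htB
  have hr0 : 0 ≤ r := hs.trans hsr
  by_cases hocc : ∃ j, Y j (J j r) = x
  · obtain ⟨j, hj⟩ := hocc
    obtain ⟨v, hv, hsub⟩ := mem_nhdsGE_iff_exists_Ico_subset.1 (h.eventually_right j hr0)
    obtain ⟨b, hb, hbv⟩ := exists_lt_of_csInf_lt ⟨t, htB⟩ (show sInf B < v from hv)
    have hJ : J j b = J j r := hsub ⟨csInf_le hBb hb, hbv⟩
    exact hb.2.2 ⟨j, by rw [hJ, hj]⟩
  · have hsr' : s < r := lt_of_le_of_ne hsr fun e => hocc ⟨i, by rw [← e]⟩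
    have hr0' : 0 < r := hs.trans_lt hsr'
    have hleft : ∀ᶠ u in 𝓝[<] r, ∃ j, Y j (J j u) = x := by
      filter_upwards [Ioo_mem_nhdsLT hsr'] with u hu
      by_contra hn
      exact absurd (csInf_le hBb (show u ∈ B from ⟨hu.1.le, hu.2.le.trans hrt, hn⟩))
        (not_le.2 hu.2)
    have hF := h.finite_visitors_until x hr0
    -- Finitely many candidates: one of them is at `x` at times arbitrarily close to `r`, hence
    -- throughout a left neighbourhood.
    obtain ⟨j, hj⟩ : ∃ j, ∃ᶠ u in 𝓝[<] r, Y j (J j u) = x := by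
      by_contra! hno
      have h1 : ∀ᶠ u in 𝓝[<] r, ∀ j ∈ {i | ∃ s, 0 ≤ s ∧ s ≤ r ∧ Y i (J i s) = x},
          Y j (J j u) ≠ x := by
        rw [Filter.eventually_all_finite hF]
        intro j _
        exact hno j
      obtain ⟨u, ⟨⟨j, hj⟩, hu⟩, hu'⟩ := ((hleft.and h1).and (Ioo_mem_nhdsLT hsr')).exists
      exact hu j ⟨u, hs.trans hu'.1.le, hu'.2.le, hj⟩ hj
    obtain ⟨N, hN⟩ := h.exists_ring_lt_iff j r
    have hconst := h.eventually_left j hr0' hN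
    have hx : Y j (activeCount R Y J j N) = x := by
      obtain ⟨u, hu1, hu2⟩ := (hj.and_eventually hconst).exists
      rw [← hu2, hu1]
    have hat : ∀ᶠ u in 𝓝[<] r, Y j (J j u) = x := by
      filter_upwards [hconst] with u hu
      rw [hu, hx]
    by_cases hring : ∃ n, R j n = r
    · obtain ⟨n, hn⟩ := hring
      -- An active `j` has a companion `k` at `x`, which does not ring at the same instant and so is
      -- still there at `r`; an inactive `j` does not move.
      by_cases hact : ActiveAt R Y J j n
      · obtain ⟨k, hkj, hk⟩ := hact
        rw [hn] at hk
        have hkn := h.eventually_left_of_ne k hr0' fun m => hn ▸ h.ring_ne k j hkj m n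
        obtain ⟨u, ⟨hu1, hu2⟩, hu3⟩ := ((hat.and hk).and hkn).exists
        exact hocc ⟨k, by rw [← hu3, hu2, hu1]⟩
      · have hJr := h.jumps_ring j n
        have hl := h.eventually_left_ring j n
        rw [activeCount_succ_of_not_active hact] at hJr
        rw [hn] at hJr hl
        obtain ⟨u, hu1, hu2⟩ := (hat.and hl).exists
        exact hocc ⟨j, by rw [hJr, ← hu2, hu1]⟩
    · push Not at hring
      obtain ⟨u, hu1, hu2⟩ := (hat.and (h.eventually_left_of_ne j hr0' hring)).exists
      exact hocc ⟨j, by rw [← hu2, hu1]⟩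

omit h in
variable (Y J) in
/-- The vertex `x` has been visited by time `t`. -/
def Visited (t : ℝ) (x : ℤ) : Prop :=
  ∃ i, ∃ s, 0 ≤ s ∧ s ≤ t ∧ Y i (J i s) = x

lemma visited_walk (i : Particle η₀) {t : ℝ} (ht : 0 ≤ t) {k : ℕ} (hk : k ≤ J i t) :
    Visited Y J t (Y i k) := by
  obtain ⟨s, hs, hst, rfl⟩ := h.exists_jumps_eq i ht hk
  exact ⟨i, s, hs, hst, rfl⟩

/-- A unit-step walk cannot pass `a` without visiting it. -/
lemma walk_lt (i : Particle η₀) {t : ℝ} (ht : 0 ≤ t) {a : ℤ} (ha : ¬ Visited Y J t a)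
    (hi : i.1 < a) {k : ℕ} (hk : k ≤ J i t) : Y i k < a := by
  induction k with
  | zero => rwa [h.start]
  | succ k ih =>
    have h1 := ih (by omega)
    have h2 : Y i (k + 1) ≠ a := fun e => ha (e ▸ h.visited_walk i ht hk)
    have h3 := h.step i k
    rcases abs_cases (Y i k - Y i (k + 1)) with ⟨e, _⟩ | ⟨e, _⟩ <;> omega

lemma lt_walk (i : Particle η₀) {t : ℝ} (ht : 0 ≤ t) {a : ℤ} (ha : ¬ Visited Y J t a)
    (hi : a < i.1) {k : ℕ} (hk : k ≤ J i t) : a < Y i k := by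
  induction k with
  | zero => rwa [h.start]
  | succ k ih =>
    have h1 := ih (by omega)
    have h2 : Y i (k + 1) ≠ a := fun e => ha (e ▸ h.visited_walk i ht hk)
    have h3 := h.step i k
    rcases abs_cases (Y i k - Y i (k + 1)) with ⟨e, _⟩ | ⟨e, _⟩ <;> omega

lemma not_visited_of_unoccupied {t : ℝ} {x : ℤ} (hx : ∀ i, Y i (J i t) ≠ x) :
    ¬ Visited Y J t x := by
  rintro ⟨i, s, hs, hst, rfl⟩
  obtain ⟨j, hj⟩ := h.exists_at_of_visited (i := i) hs hst
  exact hx j hj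

lemma exists_not_visited_ge (hη : Subcritical η₀) {t : ℝ} (ht : 0 ≤ t) (o : ℤ) :
    ∃ y, o ≤ y ∧ ¬ Visited Y J t y := by
  obtain ⟨c, C, -, hc1, -, hC⟩ := hη
  obtain ⟨y, hy, hy'⟩ := exists_unoccupied (fun i : Particle η₀ => i.1) (fun i => Y i (J i t))
    hc1 (C₀ := C)
    (fun a b => ⟨startIn η₀ (-a) b, by rw [card_startIn]; exact hC a b,
      fun i h1 h2 => mem_startIn.2 ⟨h1, h2⟩⟩)
    (fun K hK => by
      obtain ⟨D, hD⟩ := h.exists_jumps_le ht hK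
      exact ⟨D, fun i => (h.abs_walk_sub_le i _).trans (by exact_mod_cast hD i)⟩) o
  exact ⟨y, hy, h.not_visited_of_unoccupied hy'⟩

lemma exists_not_visited_le (hη : Subcritical η₀) {t : ℝ} (ht : 0 ≤ t) (o : ℤ) :
    ∃ y, y ≤ o ∧ ¬ Visited Y J t y := by
  obtain ⟨c, C, -, hc1, -, hC⟩ := hη
  obtain ⟨y, hy, hy'⟩ := exists_unoccupied (fun i : Particle η₀ => -i.1)
    (fun i => -Y i (J i t)) hc1 (C₀ := C)
    (fun a b => ⟨startIn η₀ (-b) a, by rw [card_startIn, add_comm (a : ℝ)]; exact hC b a,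
      fun i h1 h2 => mem_startIn.2 ⟨by omega, by omega⟩⟩)
    (fun K hK => by
      obtain ⟨D, hD⟩ := h.exists_jumps_le ht hK
      refine ⟨D, fun i => ?_⟩
      rw [Int.natAbs_neg, neg_sub_neg, abs_sub_comm]
      exact (h.abs_walk_sub_le i _).trans (by exact_mod_cast hD i)) (-o)
  exact ⟨-y, by omega, h.not_visited_of_unoccupied fun i hi => hy' i (by omega)⟩

/-- At all times there are unvisited vertices on both sides of `o`, at a bounded distance. -/
lemma exists_gap_at (hη : Subcritical η₀) (o : ℤ) :
    ∃ N : ℕ, ∀ t, 0 ≤ t → ∃ a b, o - N ≤ a ∧ a ≤ o ∧ o ≤ b ∧ b ≤ o + N ∧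
      ¬ Visited Y J t a ∧ ¬ Visited Y J t b := by
  classical
  obtain ⟨N, hN⟩ := hη.sum_Icc_lt o
  refine ⟨N, fun t ht => ?_⟩
  by_cases ho : Visited Y J t o
  swap
  · exact ⟨o, o, by omega, le_rfl, le_rfl, by omega, ho, ho⟩
  have hr : ∃ k : ℕ, ¬ Visited Y J t (o + k) := by
    obtain ⟨y, hy, hy'⟩ := h.exists_not_visited_ge hη ht o
    exact ⟨(y - o).toNat, by rwa [Int.toNat_of_nonneg (by omega), add_sub_cancel]⟩
  have hl : ∃ k : ℕ, ¬ Visited Y J t (o - k) := by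
    obtain ⟨y, hy, hy'⟩ := h.exists_not_visited_le hη ht o
    exact ⟨(o - y).toNat, by rwa [Int.toNat_of_nonneg (by omega), sub_sub_cancel]⟩
  obtain ⟨p, hp, hp'⟩ : ∃ p : ℕ, ¬ Visited Y J t (o + p) ∧ ∀ k < p, Visited Y J t (o + k) :=
    ⟨Nat.find hr, Nat.find_spec hr, fun k hk => not_not.1 (Nat.find_min hr hk)⟩
  obtain ⟨q, hq, hq'⟩ : ∃ q : ℕ, ¬ Visited Y J t (o - q) ∧ ∀ k < q, Visited Y J t (o - k) :=
    ⟨Nat.find hl, Nat.find_spec hl, fun k hk => not_not.1 (Nat.find_min hl hk)⟩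
  have hp0 : p ≠ 0 := fun e => hp (by simpa [e] using ho)
  have hq0 : q ≠ 0 := fun e => hq (by simpa [e] using ho)
  -- Each vertex strictly between the nearest unvisited ones is visited, hence occupied. The
  -- occupant cannot have crossed the end points, nor started at one, since time zero counts as a
  -- visit.
  have hocc : ∀ y ∈ Finset.Icc (o - q + 1) (o + p - 1), ∃ i ∈ startIn η₀ (o - q + 1) (o + p - 1),
      Y i (J i t) = y := by
    intro y hy
    rw [Finset.mem_Icc] at hy
    have hv : Visited Y J t y := by
      rcases le_total o y with hle | hle
      · have := hp' (y - o).toNat (by omega)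
        rwa [Int.toNat_of_nonneg (by omega), add_sub_cancel] at this
      · have := hq' (o - y).toNat (by omega)
        rwa [Int.toNat_of_nonneg (by omega), sub_sub_cancel] at this
    obtain ⟨i, s, hs, hst, rfl⟩ := hv
    obtain ⟨j, hj⟩ := h.exists_at_of_visited (i := i) hs hst
    refine ⟨j, mem_startIn.2 ⟨?_, ?_⟩, hj⟩
    · by_contra! hlt
      rcases lt_or_eq_of_le (show j.1 ≤ o - q by omega) with h1 | h1
      · have := h.walk_lt j ht hq h1 le_rfl
        omega
      · exact hq (h1 ▸ h.start j ▸ h.visited_walk j ht (Nat.zero_le _))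
    · by_contra! hlt
      rcases lt_or_eq_of_le (show o + p ≤ j.1 by omega) with h1 | h1
      · have := h.lt_walk j ht hp h1 le_rfl
        omega
      · exact hp (h1 ▸ h.start j ▸ h.visited_walk j ht (Nat.zero_le _))
  have : ∃ f : ℤ → Particle η₀, ∀ y ∈ Finset.Icc (o - q + 1) (o + p - 1),
      f y ∈ startIn η₀ (o - q + 1) (o + p - 1) ∧ Y (f y) (J (f y) t) = y := by
    obtain ⟨i₀, -⟩ := ho
    have : Nonempty (Particle η₀) := ⟨i₀⟩
    choose! f hf using hocc
    exact ⟨f, hf⟩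
  obtain ⟨f, hf⟩ := this
  have hcard := Finset.card_le_card_of_injOn f (fun y hy => (hf y hy).1) (by
    intro y hy z hz hyz
    rw [← (hf y hy).2, hyz, (hf z hz).2])
  rw [card_startIn, Int.card_Icc] at hcard
  have hlt : ¬ (N : ℤ) ≤ (o + p - 1) - (o - q + 1) + 1 := fun hle => by
    have := hN (o - q + 1) (o + p - 1) (by omega) (by omega) hle
    omega
  exact ⟨o - q, o + p, by omega, by omega, by omega, by omega, hq, hp⟩

/-- On both sides of `o` there are vertices that are never visited. -/
lemma exists_gap (hη : Subcritical η₀) (o : ℤ) :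
    ∃ a b, a ≤ o ∧ o ≤ b ∧ ∀ t, 0 ≤ t → ¬ Visited Y J t a ∧ ¬ Visited Y J t b := by
  obtain ⟨N, hN⟩ := h.exists_gap_at hη o
  -- `T z` is a time by which `z` has been visited if it ever is; past the largest `T z` in the
  -- window, an unvisited vertex there stays unvisited forever.
  have hT : ∀ z : ℤ, ∃ T : ℝ, ∀ t, 0 ≤ t → Visited Y J t z → Visited Y J T z := by
    intro z
    by_cases hz : ∃ t, 0 ≤ t ∧ Visited Y J t z
    · obtain ⟨t, ht, hv⟩ := hz
      exact ⟨t, fun _ _ _ => hv⟩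
    · exact ⟨0, fun t ht hv => absurd ⟨t, ht, hv⟩ hz⟩
  choose T hT using hT
  obtain ⟨M, hM⟩ := ((Finset.Icc (o - N) (o + N)).finite_toSet.image T).bddAbove
  obtain ⟨a, b, ha, hao, hob, hb, hva, hvb⟩ := hN (max M 0) (le_max_right _ _)
  have key : ∀ z, o - N ≤ z → z ≤ o + N → ¬ Visited Y J (max M 0) z →
      ∀ t, 0 ≤ t → ¬ Visited Y J t z := by
    intro z hz1 hz2 hz t ht hv
    obtain ⟨i, s, hs, hst, e⟩ := hT z t ht hv
    have hle : T z ≤ M := hM ⟨z, by simp [hz1, hz2], rfl⟩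
    exact hz ⟨i, s, hs, hst.trans (hle.trans (le_max_left _ _)), e⟩
  exact ⟨a, b, hao, hob, fun t ht => ⟨key a ha (by omega) hva t ht, key b (by omega) hb hvb t ht⟩⟩

lemma finite_visitors (hη : Subcritical η₀) (x : ℤ) :
    {i | ∃ t, 0 ≤ t ∧ Y i (J i t) = x}.Finite := by
  obtain ⟨a, b, ha, hb, hab⟩ := h.exists_gap hη x
  refine (startIn η₀ a b).finite_toSet.subset ?_
  rintro i ⟨t, ht, rfl⟩
  rw [Finset.mem_coe, mem_startIn]
  constructor
  · by_contra! hlt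
    have := h.walk_lt i ht (hab t ht).1 hlt le_rfl
    omega
  · by_contra! hlt
    have := h.lt_walk i ht (hab t ht).2 hlt le_rfl
    omega

/-- The particle is confined between two never visited vertices, so it never gets past the step at
which its walk leaves that interval. The bounded monotone jump count attains its supremum and stays
there. -/
lemma exists_forall_jumps_eq (hη : Subcritical η₀) (i : Particle η₀)
    (hexit : ∀ K : Finset ℤ, ∃ k, Y i k ∉ K) :
    ∃ T, 0 ≤ T ∧ ∀ t, T ≤ t → J i t = J i T := by
  have hbdd : BddAbove (J i '' Set.Ici 0) := by
    obtain ⟨a, b, ha, hb, hab⟩ := h.exists_gap hη i.1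
    obtain ⟨k, hk⟩ := hexit (Finset.Icc a b)
    refine ⟨k, ?_⟩
    rintro _ ⟨t, ht, rfl⟩
    by_contra! hlt
    have hv := h.visited_walk i ht (Nat.zero_le _)
    rw [h.start] at hv
    have ha' : a ≠ i.1 := fun e => (hab t ht).1 (e ▸ hv)
    have hb' : b ≠ i.1 := fun e => (hab t ht).2 (e ▸ hv)
    have h1 := h.lt_walk i ht (hab t ht).1 (by omega) hlt.le
    have h2 := h.walk_lt i ht (hab t ht).2 (by omega) hlt.le
    exact hk (Finset.mem_Icc.2 ⟨h1.le, h2.le⟩)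
  obtain ⟨T, hT0, hT⟩ := Nat.sSup_mem (Set.nonempty_Ici.image (J i)) hbdd
  refine ⟨T, hT0, fun t ht => le_antisymm ?_ (h.jumps_mono i hT0 ht)⟩
  rw [hT]
  exact le_csSup hbdd ⟨t, le_trans (Set.mem_Ici.1 hT0) ht, rfl⟩

lemma fixates (hη : Subcritical η₀) (hexit : ∀ i, ∀ K : Finset ℤ, ∃ k, Y i k ∉ K) (x : ℤ) :
    ∃ T : ℝ, 0 ≤ T ∧ ∀ t, T ≤ t →
      (¬ (0 ≤ t ∧ ∃ i, Y i (J i t) = x ∧ (0 < t → ∀ᶠ u in 𝓝[<] t, Y i (J i u) ≠ x))) ∧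
      ∀ i j, Y i (J i t) = x → Y j (J j t) = x → i = j := by
  choose T hT0 hT using fun i => h.exists_forall_jumps_eq hη i (hexit i)
  obtain ⟨M, hM⟩ := ((h.finite_visitors hη x).image T).bddAbove
  have hfix : ∀ i t, max M 0 < t → Y i (J i t) = x →
      ∀ u, max M 0 < u → J i u = J i (T i) := by
    intro i t ht hi u hu
    have hle : T i ≤ M := hM ⟨i, ⟨t, (le_max_right _ _).trans ht.le, hi⟩, rfl⟩
    exact hT i u (hle.trans ((le_max_left _ _).trans hu.le))
  -- The added one leaves a left neighbourhood of `t` on which visitors to `x` no longer jump.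
  refine ⟨max M 0 + 1, by positivity, fun t ht => ?_⟩
  have htM : max M 0 < t := by linarith
  have ht0 : 0 < t := (le_max_right _ _).trans_lt htM
  constructor
  · rintro ⟨-, i, hi, hleft⟩
    obtain ⟨u, hu1, hu2⟩ := ((hleft ht0).and (Ioo_mem_nhdsLT htM)).exists
    rw [hfix i t htM hi u hu2.1, ← hfix i t htM hi t htM] at hu1
    exact hu1 hi
  · intro i j hi hj
    by_contra hij
    obtain ⟨n, hn⟩ := h.exists_ring_gt i t
    have hMn : max M 0 < R i n := htM.trans hn
    -- Both particles rest at `x` until the next ring of `i`, which is therefore active and adds a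
    -- jump, against constancy.
    have hact : ActiveAt R Y J i n := by
      refine ⟨j, fun e => hij e.symm, ?_⟩
      filter_upwards [Ioo_mem_nhdsLT hMn] with u hu
      rw [hfix i t htM hi u hu.1, hfix j t htM hj u hu.1, ← hfix i t htM hi t htM,
        ← hfix j t htM hj t htM, hi, hj]
    have h1 := h.jumps_ring i n
    rw [activeCount_succ_of_active hact] at h1
    obtain ⟨u, hu1, hu2⟩ := ((h.eventually_left_ring i n).and (Ioo_mem_nhdsLT hMn)).exists
    rw [hfix i t htM hi u hu2.1] at hu1
    rw [hfix i t htM hi _ hMn] at h1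
    omega

end Regular

/-! ### From the process to regular realizations. -/

/-- Almost every realization of the process is regular. -/
lemma IsInfiniteSleepARW.ae_regular {Ω : Type*} [MeasurableSpace Ω] {Q : Measure Ω}
    [IsProbabilityMeasure Q] {P : ℤ → PMF ℤ} {η₀ : ℤ → ℕ} {τ : Particle η₀ → ℕ → Ω → ℝ}
    {Y : Particle η₀ → ℕ → Ω → ℤ} {J : Particle η₀ → ℝ → Ω → ℕ}
    (h : IsInfiniteSleepARW P η₀ Q τ Y J) (hP : NearestNeighbour intLine P)
    (hη : Subcritical η₀) :
    ∀ᵐ ω ∂Q, Regular (fun i n => ringTime τ i n ω) (fun i n => Y i n ω) fun i t => J i t ω := by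
  have hstart : ∀ᵐ ω ∂Q, ∀ i, Y i 0 ω = i.1 := ae_all_iff.2 fun i => (h.walk_law i).1
  have hstep : ∀ᵐ ω ∂Q, ∀ i n, P (Y i n ω) (Y i (n + 1) ω) ≠ 0 :=
    ae_all_iff.2 fun i => (h.walk_law i).ae_step_ne_zero
  filter_upwards [ae_wait_pos h.measurable_wait h.wait_law,
    ae_ringTime_ne h.measurable_wait h.wait_law h.wait_indep,
    ae_finite_ringTime_le h.measurable_wait h.wait_law h.wait_indep,
    ae_finite_fast hη h.measurable_wait h.wait_law h.wait_indep, hstart, hstep, h.jumps]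
    with ω hpos hne hfin hfast hs hst hj
  refine ⟨fun i n => ?_, fun i => ?_, hfin, hne, hfast, hs, fun i n => hP _ _ (hst i n), hj⟩
  · exact Finset.sum_pos (fun k _ => hpos i k) (Finset.nonempty_range_add_one)
  · refine strictMono_nat_of_lt_succ fun n => ?_
    rw [ringTime, ringTime, Finset.sum_range_succ _ (n + 1)]
    linarith [hpos i (n + 1)]

end ARW

theorem mainTheorem7
    (law : Measure (ℤ → ℕ)) [IsProbabilityMeasure law]
    (hergodic : Ergodic ARW.shift law)
    (hmean : ∫⁻ η, (η 0 : ℝ≥0∞) ∂law < 1)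
    (P : ℤ → PMF ℤ) (hP : ARW.NearestNeighbour ARW.intLine P) :
    ∀ᵐ η₀ ∂law,
      (∀ o : ℤ, ∀ᶠ n : ℕ in atTop, ARW.maxWeight ARW.intLine η₀ o n < n) ∧
      ∀ (Ω : Type*) [MeasurableSpace Ω] (Q : Measure Ω) [IsProbabilityMeasure Q]
        (τ : ARW.Particle η₀ → ℕ → Ω → ℝ) (Y : ARW.Particle η₀ → ℕ → Ω → ℤ)
        (J : ARW.Particle η₀ → ℝ → Ω → ℕ),
        ARW.IsInfiniteSleepARW P η₀ Q τ Y J →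
          ARW.Fixating Q (ARW.position Y J) ∧
          (∀ᵐ ω ∂Q, ∀ x : ℤ, (ARW.visitors (ARW.position Y J) x ω).Finite) ∧
          (ARW.NoFiniteTrap P →
            ∀ᵐ ω ∂Q, ∀ x : ℤ, ARW.FixatesAt (ARW.position Y J) x ω) := by
  filter_upwards [ARW.ae_subcritical law hergodic hmean] with η₀ hη
  refine ⟨hη.maxWeight_lt, fun Ω _ Q _ τ Y J h => ?_⟩
  have hreg := h.ae_regular hP hη
  refine ⟨fun hnon => ?_, ?_, fun htrap => ?_⟩
  · have hvisit : ∀ᵐ ω ∂Q, ∀ x, ARW.VisitedAtLeast (ARW.position Y J) 1 x ω :=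
      ae_all_iff.2 fun x => hnon x 1
    obtain ⟨ω, hr, hv⟩ := (hreg.and hvisit).exists
    obtain ⟨a, b, -, -, hab⟩ := hr.exists_gap hη 0
    have ha := hv a
    rw [ARW.VisitedAtLeast, Nat.cast_one, Set.one_le_encard_iff_nonempty] at ha
    obtain ⟨t, ht, i, hi, -⟩ := ha
    exact (hab t ht).1 ⟨i, t, ht, le_rfl, hi⟩
  · filter_upwards [hreg] with ω hr x
    exact hr.finite_visitors hη x
  · have hexit : ∀ᵐ ω ∂Q, ∀ i, ∀ K : Finset ℤ, ∃ k, Y i k ω ∉ K :=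
      ae_all_iff.2 fun i => ae_all_iff.2 fun K => (h.walk_law i).ae_exists_notMem htrap K
    filter_upwards [hreg, hexit] with ω hr he x
    exact hr.fixates hη he x
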